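/- For a group $G$ and an arbitrary subset $S\subseteq G$, the Haar graph $H(G,S)$ is the graph with vertex set $G\times\{0,1\}$ and edges $[(g,0),(sg,1)]$ for all $g\in G$, $s\in S$. A graph is called a Cayley graph if it is isomorphic to a graph $\mathrm{Cay}(K,T)$, where $K$ is a finite group, $T\subseteq K$ satisfies $1\notin T$ and $T=T^{-1}$, and $\mathrm{Cay}(K,T)$ is the graph with vertex set $K$ and edges $[g,tg]$ for all $g\in K$, $t\in T$. **Theorem.** Let $n\ge 2$ be an integer and let $D_n$ be the dihedral group of order $2n$ (so $D_2=\mathbb{Z}_2^2$). Then every Haar graph $H(D_n,S)$, $S\subseteq D_n$, is a Cayley graph if and only if $n\in\{2,3,4,5\}$. -/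

import Mathlib

/-- The Haar graph `H(G, S)` of a group `G` and an arbitrary subset `S`: its vertex set is
`G × {0, 1}`, and its edges are `[(g, 0), (s * g, 1)]` for `g ∈ G` and `s ∈ S`. -/
def haarGraph {G : Type*} [Group G] (S : Set G) : SimpleGraph (G × Fin 2) where
  Adj u v := ∃ g : G, ∃ s ∈ S, s(u, v) = s((g, 0), (s * g, 1))
  symm := ⟨by
    rintro u v ⟨g, s, hs, h⟩
    exact ⟨g, s, hs, by rw [Sym2.eq_swap, h]⟩⟩
  loopless := ⟨by
    rintro u ⟨g, s, -, h⟩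
    rw [Sym2.eq_iff] at h
    rcases h with ⟨h0, h1⟩ | ⟨h0, h1⟩ <;>
    · rw [h0] at h1
      simp at h1⟩

/-- The Cayley graph `Cay(G, S)` (meant for `S` with `1 ∉ S` and `S⁻¹ = S`): its vertex set is `G`,
and its edges are `[g, s * g]` for `g ∈ G` and `s ∈ S`. Mathlib's `SimpleGraph.mulCayley` multiplies
by the generators on the right; taking it over the opposite group gives left multiplication, so
here the Mathlib graph is transported along `MulOpposite.op : G → Gᵐᵒᵖ`. -/
def cayleyGraph {G : Type*} [Group G] (S : Set G) : SimpleGraph G :=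
  (SimpleGraph.mulCayley (MulOpposite.unop ⁻¹' S)).comap MulOpposite.op

/-- Adjacency in the Cayley graph of an inverse-closed set without the identity. -/
theorem cayleyGraph_adj {G : Type*} [Group G] {S : Set G} (h1 : (1 : G) ∉ S) (hS : S⁻¹ = S)
    (u v : G) : (cayleyGraph S).Adj u v ↔ ∃ s ∈ S, v = s * u := by
  simp only [cayleyGraph, SimpleGraph.comap_adj, SimpleGraph.mulCayley_adj']
  constructor
  · rintro ⟨-, g, hg, h | h⟩
    · exact ⟨g.unop, hg, by simpa using (congrArg MulOpposite.unop h).symm⟩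
    · refine ⟨(g.unop)⁻¹, ?_, ?_⟩
      · rw [← hS]
        simpa using hg
      · have h' : u = g.unop * v := by simpa using congrArg MulOpposite.unop h
        rw [h']
        simp
  · rintro ⟨s, hs, rfl⟩
    refine ⟨?_, MulOpposite.op s, hs, Or.inl rfl⟩
    intro h
    apply h1
    have h' : u = s * u := MulOpposite.op_injective h
    have hs1 : s = 1 := by simpa using h'
    exact hs1 ▸ hs

/-- A graph is a Cayley graph if it is isomorphic to `Cay(G, S)` for some finite group `G` and
some inverse-closed `S ⊆ G` that does not contain the identity. -/
def IsCayleyGraph.{u} {V : Type u} (X : SimpleGraph V) : Prop :=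
  ∃ (G : Type u) (_ : Group G) (_ : Finite G) (S : Set G),
    (1 : G) ∉ S ∧ S⁻¹ = S ∧ Nonempty (X ≃g cayleyGraph S)

/-! For `n ≥ 6`, vertex-transitivity fails. Walks of length two from the two sides of a Haar graph
reach `|S⁻¹ * S|` and `|S * S⁻¹|` vertices. If `S` consists of the rotations and the reflections
indexed by `A`, these numbers are `|A - A| + |A + A|` and `2|A - A|`, and `A = {0, 1, 3}` has fewer
sums than differences.

For `n ≤ 5`, each `A ⊆ ZMod n` satisfies `c - A = A` for some `c`. Applied to the rotations in `S`,
this gives an automorphism exchanging the sides which, with the right translations, generates a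
regular group (`isCayleyGraph_haarGraph_of_swap`); Sabidussi's theorem then applies. -/

open scoped Pointwise

section HaarAdjacency

variable {G : Type*} [Group G] {S : Set G}

theorem haarGraph_adj_zero_one (g h : G) :
    (haarGraph S).Adj (g, 0) (h, 1) ↔ h * g⁻¹ ∈ S := by
  constructor
  · rintro ⟨k, s, hs, e⟩
    rw [Sym2.eq_iff] at e
    rcases e with ⟨e0, e1⟩ | ⟨e0, -⟩
    · simp only [Prod.mk.injEq, and_true] at e0 e1
      rw [e1, e0]
      simpa using hs
    · simp at e0
  · intro hs
    exact ⟨g, h * g⁻¹, hs, by simp⟩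

theorem haarGraph_adj_one_zero (g h : G) :
    (haarGraph S).Adj (g, 1) (h, 0) ↔ g * h⁻¹ ∈ S := by
  rw [SimpleGraph.adj_comm, haarGraph_adj_zero_one]

theorem not_haarGraph_adj_same (g h : G) (i : Fin 2) :
    ¬ (haarGraph S).Adj (g, i) (h, i) := by
  rintro ⟨k, s, -, e⟩
  rw [Sym2.eq_iff] at e
  rcases e with ⟨e0, e1⟩ | ⟨e0, e1⟩ <;>
  · simp only [Prod.mk.injEq] at e0 e1
    exact absurd (e0.2.symm.trans e1.2) (by decide)

end HaarAdjacency

/-- **Sabidussi's theorem**: a graph with a simply transitive finite group of automorphisms is a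
Cayley graph. -/
theorem IsCayleyGraph.of_bijective_smul.{u} {V : Type u} {X : SimpleGraph V} {K : Type u} [Group K]
    [Finite K] [MulAction K V] (hX : ∀ (k : K) (u v : V), X.Adj u v → X.Adj (k • u) (k • v))
    (v₀ : V) (hv : Function.Bijective fun k : K => k • v₀) : IsCayleyGraph X := by
  have hX' (k : K) (u v : V) : X.Adj (k • u) (k • v) ↔ X.Adj u v :=
    ⟨fun h => by simpa using hX k⁻¹ _ _ h, hX k u v⟩
  have h1 : (1 : K) ∉ {t : K | X.Adj v₀ (t⁻¹ • v₀)} := by simp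
  have hT : {t : K | X.Adj v₀ (t⁻¹ • v₀)}⁻¹ = {t : K | X.Adj v₀ (t⁻¹ • v₀)} := by
    ext t
    change X.Adj v₀ (t⁻¹⁻¹ • v₀) ↔ X.Adj v₀ (t⁻¹ • v₀)
    rw [inv_inv, ← hX' t v₀ (t⁻¹ • v₀), smul_inv_smul, SimpleGraph.adj_comm]
  -- Edges of `cayleyGraph` come from left multiplication, so `k` must label the vertex `k⁻¹ • v₀`.
  refine ⟨K, inferInstance, inferInstance, _, h1, hT, ⟨RelIso.symm ⟨(Equiv.inv K).trans
    (Equiv.ofBijective _ hv), ?_⟩⟩⟩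
  intro a b
  simp only [Equiv.trans_apply, Equiv.inv_apply, Equiv.ofBijective_apply]
  rw [cayleyGraph_adj h1 hT, ← hX' a, smul_inv_smul, smul_smul]
  constructor
  · intro h
    exact ⟨b * a⁻¹, by simpa using h, by simp⟩
  · rintro ⟨s, hs, rfl⟩
    simpa using hs

/-- Cayley graphs are vertex-transitive. -/
theorem IsCayleyGraph.exists_iso_apply_eq {V : Type*} {X : SimpleGraph V} (hX : IsCayleyGraph X)
    (u v : V) : ∃ e : X ≃g X, e u = v := by
  obtain ⟨K, _, _, T, h1, hT, ⟨f⟩⟩ := hX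
  let ρ : cayleyGraph T ≃g cayleyGraph T :=
    ⟨Equiv.mulRight ((f u)⁻¹ * f v), by
      intro a b
      simp [cayleyGraph_adj h1 hT, ← mul_assoc]⟩
  refine ⟨(f.trans ρ).trans f.symm, ?_⟩
  rw [RelIso.trans_apply, RelIso.trans_apply, RelIso.symm_apply_eq]
  change f u * ((f u)⁻¹ * f v) = f v
  simp

/-- The number of ends of walks of length two is preserved by automorphisms. -/
theorem ncard_walks_two_iso {V : Type*} {X : SimpleGraph V} (e : X ≃g X) (v : V) :
    {w | ∃ u, X.Adj (e v) u ∧ X.Adj u w}.ncard = {w | ∃ u, X.Adj v u ∧ X.Adj u w}.ncard := by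
  rw [← Set.ncard_image_of_injective {w | ∃ u, X.Adj v u ∧ X.Adj u w} e.injective]
  congr 1
  ext w
  constructor
  · rintro ⟨u, h, h'⟩
    refine ⟨e.symm w, ⟨e.symm u, ?_, ?_⟩, by simp⟩
    · rw [← e.map_adj_iff]; simpa using h
    · rw [← e.map_adj_iff]; simpa using h'
  · rintro ⟨w, ⟨u, h, h'⟩, rfl⟩
    exact ⟨e u, e.map_adj_iff.2 h, e.map_adj_iff.2 h'⟩

/-! ### Two-step walks and side-exchanging automorphisms of Haar graphs -/

section Haar

variable {G : Type*} [Group G] {S : Set G}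

theorem ncard_walks_two_haarGraph_zero :
    {w | ∃ u, (haarGraph S).Adj (1, 0) u ∧ (haarGraph S).Adj u w}.ncard = (S⁻¹ * S).ncard := by
  rw [← Set.ncard_image_of_injective (S⁻¹ * S) (Prod.mk_left_injective (0 : Fin 2))]
  congr 1
  ext ⟨w, i⟩
  simp only [Set.mem_ofPred_eq, Set.mem_image, Set.mem_mul, Prod.mk.injEq]
  constructor
  · rintro ⟨⟨u, j⟩, h, h'⟩
    fin_cases j
    · exact absurd h (not_haarGraph_adj_same _ _ _)
    fin_cases i
    · have hu := (haarGraph_adj_zero_one _ _).1 h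
      have hw := (haarGraph_adj_one_zero _ _).1 h'
      exact ⟨w, ⟨w * u⁻¹, by simpa using hw, u, by simpa using hu, by simp⟩, rfl, rfl⟩
    · exact absurd h' (not_haarGraph_adj_same _ _ _)
  · rintro ⟨_, ⟨t, ht, s, hs, rfl⟩, rfl, rfl⟩
    refine ⟨(s, 1), ?_, ?_⟩
    · rw [haarGraph_adj_zero_one]; simpa using hs
    · rw [haarGraph_adj_one_zero]; simpa using ht

theorem ncard_walks_two_haarGraph_one :
    {w | ∃ u, (haarGraph S).Adj (1, 1) u ∧ (haarGraph S).Adj u w}.ncard = (S * S⁻¹).ncard := by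
  rw [← Set.ncard_image_of_injective (S * S⁻¹) (Prod.mk_left_injective (1 : Fin 2))]
  congr 1
  ext ⟨w, i⟩
  simp only [Set.mem_ofPred_eq, Set.mem_image, Set.mem_mul, Prod.mk.injEq]
  constructor
  · rintro ⟨⟨u, j⟩, h, h'⟩
    fin_cases j
    swap
    · exact absurd h (not_haarGraph_adj_same _ _ _)
    fin_cases i
    · exact absurd h' (not_haarGraph_adj_same _ _ _)
    · have hu := (haarGraph_adj_one_zero _ _).1 h
      have hw := (haarGraph_adj_zero_one _ _).1 h'
      exact ⟨w, ⟨w * u⁻¹, hw, u, by simpa using hu, by simp⟩, rfl, rfl⟩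
  · rintro ⟨_, ⟨t, ht, s, hs, rfl⟩, rfl, rfl⟩
    refine ⟨(s, 0), ?_, ?_⟩
    · rw [haarGraph_adj_one_zero]; simpa using hs
    · rw [haarGraph_adj_zero_one]; simpa using ht

/-- The obstruction used for `n ≥ 6`: some automorphism carries `(1, 0)` to `(1, 1)`. -/
theorem IsCayleyGraph.ncard_inv_mul_eq (h : IsCayleyGraph (haarGraph S)) :
    (S⁻¹ * S).ncard = (S * S⁻¹).ncard := by
  obtain ⟨e, he⟩ := h.exists_iso_apply_eq (1, 0) (1, 1)
  rw [← ncard_walks_two_haarGraph_zero, ← ncard_walks_two_haarGraph_one, ← he,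
    ncard_walks_two_iso]

/-- Right translation, as an automorphism of a Haar graph. -/
def haarTranslation (S : Set G) (h : G) : haarGraph S ≃g haarGraph S where
  toEquiv := (Equiv.mulRight h).prodCongr (Equiv.refl _)
  map_rel_iff' := by
    rintro ⟨a, i⟩ ⟨b, j⟩
    fin_cases i <;> fin_cases j <;>
      simp [haarGraph_adj_zero_one, haarGraph_adj_one_zero, not_haarGraph_adj_same]

theorem haarTranslation_apply (h a : G) (i : Fin 2) :
    haarTranslation S h (a, i) = (a * h, i) := rfl

variable {α : G →* G} {y : G}

/-- The automorphism of a Haar graph that exchanges the two sides by means of an automorphism `α`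
of the group whose square is conjugation by `y⁻¹`. -/
def haarSwap (S : Set G) (α : G →* G) (y : G) (hy : α y = y) (hα : ∀ g, α (α g) = y⁻¹ * g * y)
    (hS : ∀ s ∈ S, (y * α s)⁻¹ ∈ S) : haarGraph S ≃g haarGraph S where
  toFun v := if v.2 = 0 then (α v.1, 1) else (y * α v.1, 0)
  invFun v := if v.2 = 0 then (α v.1 * y⁻¹, 1) else (y * α v.1 * y⁻¹, 0)
  left_inv := by
    rintro ⟨a, i⟩
    fin_cases i <;> simp [hα, hy, mul_assoc]
  right_inv := by
    rintro ⟨a, i⟩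
    fin_cases i <;> simp [hα, hy, mul_assoc]
  map_rel_iff' := by
    -- The map `s ↦ (y * α s)⁻¹` is an involution, so one implication suffices.
    have hS' (s : G) : (y * α s)⁻¹ ∈ S ↔ s ∈ S := by
      refine ⟨fun h => ?_, hS s⟩
      simpa [hα, hy, mul_assoc] using hS _ h
    rintro ⟨a, i⟩ ⟨b, j⟩
    fin_cases i <;> fin_cases j <;>
      simp [haarGraph_adj_zero_one, haarGraph_adj_one_zero, not_haarGraph_adj_same]
    · rw [← hS' (b * a⁻¹)]; simp [mul_assoc]
    · rw [← hS' (a * b⁻¹)]; simp [mul_assoc]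

/-- A Haar graph with a side-exchanging automorphism that normalizes the right translations and
squares to one of them is a Cayley graph. -/
theorem isCayleyGraph_haarGraph_of_swap [Finite G] (hy : α y = y)
    (hα : ∀ g, α (α g) = y⁻¹ * g * y) (hS : ∀ s ∈ S, (y * α s)⁻¹ ∈ S) :
    IsCayleyGraph (haarGraph S) := by
  let R := haarTranslation S
  let φ := haarSwap S α y hy hα hS
  have hR (a b : G) : R a * R b = R (b * a) := by
    ext ⟨g, i⟩ <;> simp [R, RelIso.mul_apply, haarTranslation_apply, mul_assoc]
  have hR1 : R 1 = 1 := by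
    ext ⟨g, i⟩ <;> simp [R, haarTranslation_apply]
  have hφ0 (g : G) : φ (g, 0) = (α g, 1) := rfl
  have hφ1 (g : G) : φ (g, 1) = (y * α g, 0) := rfl
  have hφR (a : G) : φ * R a = R (α a) * φ := by
    refine RelIso.ext ?_
    rintro ⟨g, i⟩
    fin_cases i <;> simp [R, RelIso.mul_apply, haarTranslation_apply, hφ0, hφ1, mul_assoc]
  have hφφ : φ * φ = R y := by
    refine RelIso.ext ?_
    rintro ⟨g, i⟩
    fin_cases i <;> simp [R, RelIso.mul_apply, haarTranslation_apply, hφ0, hφ1, hα, hy, mul_assoc]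
  -- The translations and their coset by `φ`: the first move `(1, 0)` regularly over side 0, the
  -- second over side 1.
  let K : Subgroup (haarGraph S ≃g haarGraph S) :=
    { carrier := {σ | ∃ h, σ = R h ∨ σ = R h * φ}
      one_mem' := ⟨1, Or.inl hR1.symm⟩
      mul_mem' := by
        rintro _ _ ⟨a, rfl | rfl⟩ ⟨b, rfl | rfl⟩
        · exact ⟨b * a, Or.inl (hR a b)⟩
        · exact ⟨b * a, Or.inr (by rw [← mul_assoc, hR])⟩
        · exact ⟨α b * a, Or.inr (by rw [mul_assoc, hφR, ← mul_assoc, hR])⟩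
        · refine ⟨y * (α b * a), Or.inl ?_⟩
          rw [mul_assoc, ← mul_assoc φ, hφR, mul_assoc, hφφ, ← mul_assoc, hR, hR]
      inv_mem' := by
        rintro _ ⟨a, rfl | rfl⟩
        · exact ⟨a⁻¹, Or.inl (inv_eq_of_mul_eq_one_right (by rw [hR, inv_mul_cancel, hR1]))⟩
        · refine ⟨(y * α a)⁻¹, Or.inr (inv_eq_of_mul_eq_one_left ?_)⟩
          rw [mul_assoc, ← mul_assoc φ, hφR, mul_assoc, hφφ, hR, hR, mul_inv_cancel, hR1] }
  have hbij : Function.Bijective fun k : K => k • ((1, 0) : G × Fin 2) := by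
    constructor
    · rintro ⟨_, a, rfl | rfl⟩ ⟨_, b, rfl | rfl⟩ h
      · change R a (1, 0) = R b (1, 0) at h
        simp_all [R, haarTranslation_apply]
      · change R a (1, 0) = R b (φ (1, 0)) at h
        simp [R, haarTranslation_apply, hφ0] at h
      · change R a (φ (1, 0)) = R b (1, 0) at h
        simp [R, haarTranslation_apply, hφ0] at h
      · change R a (φ (1, 0)) = R b (φ (1, 0)) at h
        simp_all [R, haarTranslation_apply]
    · rintro ⟨a, i⟩
      fin_cases i
      · exact ⟨⟨R a, a, Or.inl rfl⟩, by
          change R a (1, 0) = _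
          simp [R, haarTranslation_apply]⟩
      · exact ⟨⟨R a * φ, a, Or.inr rfl⟩, by
          change R a (φ (1, 0)) = _
          simp [R, haarTranslation_apply, hφ0]⟩
  have : Finite K := Finite.of_injective _ hbij.1
  exact IsCayleyGraph.of_bijective_smul (K := K) (fun k u v h => k.1.map_adj_iff.2 h)
    (1, 0) hbij

end Haar

/-! ### Dihedral groups -/

namespace DihedralGroup

variable {n : ℕ}

/-- The automorphism of the dihedral group that fixes the rotations and sends `sr i` to
`sr (i + c)`. -/
def shiftReflections (c : ZMod n) : DihedralGroup n →* DihedralGroup n where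
  toFun
    | r i => r i
    | sr i => sr (i + c)
  map_one' := rfl
  map_mul' := by
    rintro (a | a) (b | b) <;> simp <;> ring

theorem shiftReflections_r (c i : ZMod n) : shiftReflections c (r i) = r i := rfl

theorem shiftReflections_sr (c i : ZMod n) : shiftReflections c (sr i) = sr (i + c) := rfl

/-- Only rotations are constrained: with `α = shiftReflections (-c)` and `y = r (-c)`, the map `s ↦
(y * α s)⁻¹` fixes every reflection and sends `r a` to `r (c - a)`. -/
theorem isCayleyGraph_haarGraph [NeZero n] (S : Set (DihedralGroup n)) (c : ZMod n)
    (hc : ∀ a, r a ∈ S → r (c - a) ∈ S) : IsCayleyGraph (haarGraph S) := by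
  refine isCayleyGraph_haarGraph_of_swap (α := shiftReflections (-c)) (y := r (-c)) rfl ?_ ?_
  · rintro (a | a) <;> simp [shiftReflections_r, shiftReflections_sr, sub_eq_add_neg]
  · rintro (a | a) h
    · simpa [shiftReflections_r, sub_eq_add_neg, add_comm] using hc a h
    · simpa [shiftReflections_sr] using h

theorem exists_iff {p : DihedralGroup n → Prop} :
    (∃ g, p g) ↔ (∃ i, p (r i)) ∨ ∃ i, p (sr i) := by
  constructor
  · rintro ⟨g | g, h⟩
    exacts [Or.inl ⟨g, h⟩, Or.inr ⟨g, h⟩]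
  · rintro (⟨i, h⟩ | ⟨i, h⟩) <;> exact ⟨_, h⟩

/-- Sums arise because `(r a)⁻¹ * sr b = sr (a + b)`; in the opposite order, `r a * (sr b)⁻¹ = sr (b
- a)` gives differences. -/
theorem inv_mul_reflection_double (A : Finset (ZMod n)) :
    ((r '' (A : Set (ZMod n)) ∪ sr '' A)⁻¹ * (r '' A ∪ sr '' A) : Set (DihedralGroup n)) =
      r '' (A - A : Set (ZMod n)) ∪ sr '' (A + A : Set (ZMod n)) := by
  ext (x | x) <;> simp [Set.mem_mul, Set.mem_sub, Set.mem_add, exists_iff]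
  · constructor
    · rintro (⟨a, ha, b, hb, rfl⟩ | ⟨a, ha, b, hb, rfl⟩)
      · exact ⟨b, hb, -a, ha, by ring⟩
      · exact ⟨b, hb, a, ha, rfl⟩
    · rintro ⟨a, ha, b, hb, rfl⟩
      exact Or.inr ⟨b, hb, a, ha, rfl⟩
  · rintro a ha b hb rfl
    exact ⟨b, hb, -a, ha, by ring⟩

theorem mul_inv_reflection_double (A : Finset (ZMod n)) :
    ((r '' (A : Set (ZMod n)) ∪ sr '' A) * (r '' A ∪ sr '' A)⁻¹ : Set (DihedralGroup n)) =
      r '' (A - A : Set (ZMod n)) ∪ sr '' (A - A : Set (ZMod n)) := by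
  ext (x | x) <;> simp [Set.mem_mul, Set.mem_sub, exists_iff]
  · constructor
    · rintro (⟨a, ha, b, hb, rfl⟩ | ⟨a, ha, b, hb, rfl⟩)
      · exact ⟨a, ha, -b, hb, by ring⟩
      · exact ⟨b, hb, a, ha, rfl⟩
    · rintro ⟨a, ha, b, hb, rfl⟩
      exact Or.inr ⟨b, hb, a, ha, rfl⟩
  · constructor
    · rintro (⟨a, ha, b, hb, rfl⟩ | ⟨a, ha, b, hb, rfl⟩)
      · exact ⟨b, hb, a, ha, rfl⟩
      · exact ⟨a, ha, -b, hb, by ring⟩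
    · rintro ⟨a, ha, b, hb, rfl⟩
      exact Or.inl ⟨b, hb, a, ha, rfl⟩

theorem ncard_union_rotations_reflections (A B : Finset (ZMod n)) :
    (r '' (A : Set (ZMod n)) ∪ sr '' (B : Set (ZMod n)) : Set (DihedralGroup n)).ncard =
      A.card + B.card := by
  rw [Set.ncard_union_eq _ (A.finite_toSet.image _) (B.finite_toSet.image _),
    Set.ncard_image_of_injective _ fun a b h => r.inj h,
    Set.ncard_image_of_injective _ fun a b h => sr.inj h, Set.ncard_coe_finset,
    Set.ncard_coe_finset]
  rw [Set.disjoint_left]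
  rintro _ ⟨a, -, rfl⟩ ⟨b, -, h⟩
  cases h

theorem not_isCayleyGraph_haarGraph_double [DecidableEq (ZMod n)] {A : Finset (ZMod n)}
    (hA : (A + A).card < (A - A).card) :
    ¬ IsCayleyGraph (haarGraph (r '' (A : Set (ZMod n)) ∪ sr '' A)) := by
  intro h
  have h := h.ncard_inv_mul_eq
  rw [inv_mul_reflection_double, mul_inv_reflection_double, ← Finset.coe_add, ← Finset.coe_sub,
    ncard_union_rotations_reflections, ncard_union_rotations_reflections] at h
  omega

end DihedralGroup

/-! ### Sums, differences and symmetry in `ZMod n` -/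

theorem ZMod.card_add_lt_card_sub_zero_one_three {n : ℕ} (hn : 6 ≤ n) :
    (({0, 1, 3} : Finset (ZMod n)) + {0, 1, 3}).card <
      (({0, 1, 3} : Finset (ZMod n)) - {0, 1, 3}).card := by
  -- For `n = 6` the differences `3` and `-3` coincide, leaving 6 differences against 5 sums.
  obtain rfl | hn := hn.eq_or_lt
  · decide
  have hadd : (({0, 1, 3} : Finset (ZMod n)) + {0, 1, 3}) ⊆ {0, 1, 2, 3, 4, 6} := by
    intro x
    simp only [Finset.mem_add, Finset.mem_insert, Finset.mem_singleton]
    rintro ⟨_, rfl | rfl | rfl, _, rfl | rfl | rfl, rfl⟩ <;> norm_num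
  -- The differences are `-3, …, 3`, distinct once `n ≥ 7`.
  have hsub : (Finset.range 7).image (fun k : ℕ => (k : ZMod n) - 3) ⊆
      ({0, 1, 3} : Finset (ZMod n)) - {0, 1, 3} := by
    intro x
    simp only [Finset.mem_image, Finset.mem_range, Finset.mem_sub, Finset.mem_insert,
      Finset.mem_singleton]
    rintro ⟨k, hk, rfl⟩
    interval_cases k
    · exact ⟨0, by simp, 3, by simp, by norm_num⟩
    · exact ⟨1, by simp, 3, by simp, by norm_num⟩
    · exact ⟨0, by simp, 1, by simp, by norm_num⟩
    · exact ⟨0, by simp, 0, by simp, by norm_num⟩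
    · exact ⟨1, by simp, 0, by simp, by norm_num⟩
    · exact ⟨3, by simp, 1, by simp, by norm_num⟩
    · exact ⟨3, by simp, 0, by simp, by norm_num⟩
  have hcard : ((Finset.range 7).image (fun k : ℕ => (k : ZMod n) - 3)).card = 7 := by
    rw [Finset.card_image_of_injOn, Finset.card_range]
    intro a ha b hb h
    simp only [Finset.coe_range, Set.mem_Iio] at ha hb
    have h := (ZMod.natCast_eq_natCast_iff' _ _ _).1 (sub_left_injective h)
    rwa [Nat.mod_eq_of_lt (by omega), Nat.mod_eq_of_lt (by omega)] at h
  calc _ ≤ _ := Finset.card_le_card hadd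
    _ ≤ 6 := Finset.card_le_six
    _ < 7 := by norm_num
    _ ≤ _ := hcard ▸ Finset.card_le_card hsub

/-- For `n ≤ 5` every subset of `ZMod n` is symmetric up to translation. -/
theorem ZMod.exists_sub_mem {n : ℕ} (hn : n ∈ ({2, 3, 4, 5} : Set ℕ)) (A : Set (ZMod n)) :
    ∃ c, ∀ a ∈ A, c - a ∈ A := by
  classical
  -- Boolean indicator functions make this a finite check.
  have key : ∀ p : ZMod n → Bool, ∃ c, ∀ a, p a = true → p (c - a) = true := by
    rcases hn with rfl | rfl | rfl | rfl <;> decide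
  simpa using key fun a => decide (a ∈ A)

theorem theorem3p1 (n : ℕ) (hn : 2 ≤ n) :
    (∀ S : Set (DihedralGroup n), IsCayleyGraph (haarGraph S)) ↔
      n ∈ ({2, 3, 4, 5} : Set ℕ) := by
  constructor
  · intro h
    by_contra hmem
    have h6 : 6 ≤ n := by
      simp only [Set.mem_insert_iff, Set.mem_singleton_iff] at hmem
      omega
    exact DihedralGroup.not_isCayleyGraph_haarGraph_double
      (ZMod.card_add_lt_card_sub_zero_one_three h6) (h _)
  · intro hmem S
    have : NeZero n := ⟨by omega⟩
    obtain ⟨c, hc⟩ := ZMod.exists_sub_mem hmem {a | DihedralGroup.r a ∈ S}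
    exact DihedralGroup.isCayleyGraph_haarGraph S c hc
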